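/- A \emph{Brouwerian algebra} is an algebra $\langle A;\to,\wedge,\vee,\top\rangle$ such that $\langle A;\wedge,\vee\rangle$ is a lattice with greatest element $\top$ and $a\wedge b\le c\iff a\le b\to c$ for all $a,b,c\in A$; a \emph{Heyting algebra} is a Brouwerian algebra with a least element $\bot$, which is added to the signature. A \emph{variety} is a class of similar algebras closed under homomorphic images, subalgebras and direct products; it is \emph{finitely generated} if it is the least variety containing some finite set of finite algebras. For a class $\mathsf{K}$ of similar algebras, a \emph{$\mathsf{K}$-epimorphism} is a homomorphism $h\colon A\to B$ with $A,B\in\mathsf{K}$ such that, for all homomorphisms $f,g\colon B\to C$ with $C\in\mathsf{K}$, $f\circ h=g\circ h$ implies $f=g$. The \emph{depth} of a Heyting or Brouwerian algebra $A$ is the supremum in $\{0,1,2,\dots,\infty\}$ of the numbers of elements of finite chains of proper prime filters of $A$, i.e. non-empty proper lattice filters with complement closed under $\vee$, ordered by inclusion (it is $0$ if there are no proper prime filters); the depth of a class of such algebras is the supremum of the depths of its members. \textbf{Corollary.} Let $\mathsf{K}$ be a finitely generated variety of Heyting algebras, or a finitely generated variety of Brouwerian algebras. Then every $\mathsf{K}$-epimorphism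 is surjective. Moreover, $\mathsf{K}$ has finite depth. -/

import Mathlib

universe u

/-- The depth of a Heyting or Brouwerian algebra: the supremum, over all proper prime filters `p`,
of the largest number of elements of a chain of proper prime filters that starts at `p` and goes
upwards. It is `0` if there is no proper prime filter. -/
noncomputable def latticeDepth (A : Type u) [GeneralizedHeytingAlgebra A] : ℕ∞ :=
  ⨆ p : {F : Order.PFilter A // F.IsPrime}, (Order.coheight p + 1)

namespace HeytingVariety

/-- A variety of Heyting algebras: a class of Heyting algebras closed under homomorphic images,
(isomorphic copies of) subalgebras, and direct products. -/
structure IsVariety (K : Set HeytAlg.{u}) : Prop where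
  hom_image : ∀ A ∈ K, ∀ (B : HeytAlg.{u}) (f : HeytingHom A B), Function.Surjective f → B ∈ K
  subalgebra : ∀ B ∈ K, ∀ (A : HeytAlg.{u}) (f : HeytingHom A B), Function.Injective f → A ∈ K
  product : ∀ (ι : Type u) (A : ι → HeytAlg.{u}), (∀ i, A i ∈ K) → HeytAlg.of (∀ i, A i) ∈ K

/-- The variety generated by a class `M`: the least variety containing `M`. -/
def generated (M : Set HeytAlg.{u}) : Set HeytAlg.{u} :=
  ⋂₀ {V | IsVariety V ∧ M ⊆ V}

theorem isVariety_generated (M : Set HeytAlg.{u}) : IsVariety (generated M) where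
  hom_image A hA B f hf V hV := hV.1.hom_image A (hA V hV) B f hf
  subalgebra B hB A f hf V hV := hV.1.subalgebra B (hB V hV) A f hf
  product ι A hA V hV := hV.1.product ι A fun i => hA i V hV

/-- `K` is a finitely generated variety: it is generated by finitely many finite algebras. -/
def IsFinitelyGenerated (K : Set HeytAlg.{u}) : Prop :=
  ∃ M : Set HeytAlg.{u}, M.Finite ∧ (∀ A ∈ M, Finite A) ∧ K = generated M

/-- A homomorphism `h : A → B` is a `K`-epimorphism if it is right-cancellable with respect to
homomorphisms from `B` into members of `K`. -/
def IsEpi (K : Set HeytAlg.{u}) {A B : HeytAlg.{u}} (h : HeytingHom A B) : Prop :=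
  ∀ C ∈ K, ∀ f g : HeytingHom B C, f.comp h = g.comp h → f = g

/-- The epimorphism surjectivity property of a class of Heyting algebras. -/
def HasES (K : Set HeytAlg.{u}) : Prop :=
  ∀ A ∈ K, ∀ B ∈ K, ∀ h : HeytingHom A B, IsEpi K h → Function.Surjective h

/-- The supremum of the depths of the members of `K`. -/
noncomputable def depth (K : Set HeytAlg.{u}) : ℕ∞ :=
  ⨆ A ∈ K, latticeDepth A

end HeytingVariety

/-- A (bundled) Brouwerian algebra. An integral idempotent commutative residuated lattice is a
lattice with top in which `a ⊓ ·` is residuated, that is, a `GeneralizedHeytingAlgebra`. -/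
structure BrouwerianAlg where
  carrier : Type u
  [str : GeneralizedHeytingAlgebra carrier]

attribute [instance] BrouwerianAlg.str

instance : CoeSort BrouwerianAlg.{u} (Type u) := ⟨BrouwerianAlg.carrier⟩

/-- Homomorphisms of Brouwerian algebras, in the signature `⇨, ⊓, ⊔, ⊤`. -/
structure BrouwerianHom (A B : Type u) [GeneralizedHeytingAlgebra A]
    [GeneralizedHeytingAlgebra B] extends LatticeHom A B where
  map_top' : toFun ⊤ = ⊤
  map_himp' : ∀ a b, toFun (a ⇨ b) = toFun a ⇨ toFun b

namespace BrouwerianVariety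

/-- A variety of Brouwerian algebras: a class of Brouwerian algebras closed under homomorphic
images, (isomorphic copies of) subalgebras, and direct products. -/
structure IsVariety (K : Set BrouwerianAlg.{u}) : Prop where
  hom_image : ∀ A ∈ K, ∀ (B : BrouwerianAlg.{u}) (f : BrouwerianHom A B),
    Function.Surjective f.toFun → B ∈ K
  subalgebra : ∀ B ∈ K, ∀ (A : BrouwerianAlg.{u}) (f : BrouwerianHom A B),
    Function.Injective f.toFun → A ∈ K
  product : ∀ (ι : Type u) (A : ι → BrouwerianAlg.{u}), (∀ i, A i ∈ K) →
    BrouwerianAlg.mk (∀ i, A i) ∈ K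

/-- The variety generated by a class `M`: the least variety containing `M`. -/
def generated (M : Set BrouwerianAlg.{u}) : Set BrouwerianAlg.{u} :=
  ⋂₀ {V | IsVariety V ∧ M ⊆ V}

theorem isVariety_generated (M : Set BrouwerianAlg.{u}) : IsVariety (generated M) where
  hom_image A hA B f hf V hV := hV.1.hom_image A (hA V hV) B f hf
  subalgebra B hB A f hf V hV := hV.1.subalgebra B (hB V hV) A f hf
  product ι A hA V hV := hV.1.product ι A fun i => hA i V hV

/-- `K` is a finitely generated variety: it is generated by finitely many finite algebras. -/
def IsFinitelyGenerated (K : Set BrouwerianAlg.{u}) : Prop :=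
  ∃ M : Set BrouwerianAlg.{u}, M.Finite ∧ (∀ A ∈ M, Finite A) ∧ K = generated M

/-- A homomorphism `h : A → B` is a `K`-epimorphism if it is right-cancellable with respect to
homomorphisms from `B` into members of `K`. -/
def IsEpi (K : Set BrouwerianAlg.{u}) {A B : BrouwerianAlg.{u}} (h : BrouwerianHom A B) : Prop :=
  ∀ C ∈ K, ∀ f g : BrouwerianHom B C, f.toFun ∘ h.toFun = g.toFun ∘ h.toFun → f = g

/-- The epimorphism surjectivity property of a class of Brouwerian algebras. -/
def HasES (K : Set BrouwerianAlg.{u}) : Prop :=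
  ∀ A ∈ K, ∀ B ∈ K, ∀ h : BrouwerianHom A B, IsEpi K h → Function.Surjective h.toFun

/-- The supremum of the depths of the members of `K`. -/
noncomputable def depth (K : Set BrouwerianAlg.{u}) : ℕ∞ :=
  ⨆ A ∈ K, latticeDepth A

end BrouwerianVariety

/-! The argument is dual, in the posets of prime filters. For prime quotients to have at most `k`
elements amounts to an identity, so it passes from finitely many finite generators to all of `K`. A
prime filter above `x` is determined by its image in the quotient by `x`. Hence at most `2 ^ k`
prime filters lie above `x` (`finite_cone`), and this bounds the depth.

Let `h : A → B` be non-surjective. If all preimages of prime filters under `h` are proper, two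
distinct prime filters `x`, `y` have the same preimage. As cones are finite, such a pair can be
chosen minimal; then everything strictly above one is above the other. Moving `x` to `y` and fixing
the rest of the cone of `x` is therefore a bounded morphism. Its dual and `coneHom x` are distinct
homomorphisms into the up-sets of the cone that agree on the range of `h`. If instead the range of
`h` lies in some `x`, the constant map `⊤` replaces that dual (`exists_coneHom_ne`). The target is a
quotient of `B` (`coneHom_surjective`), so it belongs to `K` and `h` is not an epimorphism. -/

open Order

/-- The poset of proper prime filters of a generalized Heyting algebra. -/
abbrev PrimeFilter (A : Type u) [GeneralizedHeytingAlgebra A] : Type u :=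
  {F : PFilter A // F.IsPrime}

/-! ### Separation by prime filters and duals of homomorphisms. -/

namespace PrimeFilter

variable {A B : Type u} [GeneralizedHeytingAlgebra A] [GeneralizedHeytingAlgebra B]

theorem sup_mem_iff (x : PrimeFilter A) {a b : A} : a ⊔ b ∈ x.1 ↔ a ∈ x.1 ∨ b ∈ x.1 := by
  constructor
  · intro h
    by_contra! hc
    exact Ideal.sup_mem (s := x.2.compl_ideal.toIdeal) (x := a) (y := b) hc.1 hc.2 h
  · rintro (h | h)
    · exact PFilter.mem_of_le le_sup_left h
    · exact PFilter.mem_of_le le_sup_right h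

theorem exists_notMem (x : PrimeFilter A) : ∃ a, a ∉ x.1 :=
  x.2.compl_ideal.Nonempty

theorem ext_mem {x y : PrimeFilter A} (h : ∀ a, a ∈ x.1 ↔ a ∈ y.1) : x = y :=
  Subtype.ext (SetLike.ext h)

/-- The prime filter separation theorem. -/
theorem exists_of_infClosed_of_supClosed {F I : Set A} (hF : InfClosed F) (hI : SupClosed I)
    (hFn : F.Nonempty) (hIn : I.Nonempty) (hFI : ∀ a ∈ F, ∀ b ∈ I, ¬ a ≤ b) :
    ∃ x : PrimeFilter A, (∀ a ∈ F, a ∈ x.1) ∧ ∀ b ∈ I, b ∉ x.1 := by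
  have hG : IsPFilter {c : A | ∃ a ∈ F, a ≤ c} := by
    refine .of_def ?_ ?_ ?_
    · exact hFn.imp fun a ha => ⟨a, ha, le_rfl⟩
    · rintro c ⟨a, ha, hac⟩ d ⟨b, hb, hbd⟩
      exact ⟨a ⊓ b, ⟨_, hF ha hb, le_rfl⟩, inf_le_left.trans hac, inf_le_right.trans hbd⟩
    · rintro c d hcd ⟨a, ha, hac⟩
      exact ⟨a, ha, hac.trans hcd⟩
  have hJ : IsIdeal {c : A | ∃ b ∈ I, c ≤ b} := by
    refine ⟨?_, ?_, ?_⟩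
    · rintro c d hdc ⟨b, hb, hcb⟩
      exact ⟨b, hb, hdc.trans hcb⟩
    · exact hIn.imp fun b hb => ⟨b, hb, le_rfl⟩
    · rintro c ⟨a, ha, hac⟩ d ⟨b, hb, hbd⟩
      exact ⟨a ⊔ b, ⟨_, hI ha hb, le_rfl⟩, hac.trans le_sup_left, hbd.trans le_sup_right⟩
  have hdisj : Disjoint (hG.toPFilter : Set A) (hJ.toIdeal : Set A) := by
    rw [Set.disjoint_left]
    rintro c ⟨a, ha, hac⟩ ⟨b, hb, hcb⟩
    exact hFI a ha b hb (hac.trans hcb)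
  obtain ⟨J, hJp, hIJ, hFJ⟩ := DistribLattice.prime_ideal_of_disjoint_filter_ideal hdisj
  refine ⟨⟨hJp.toPrimePair.F, ⟨?_⟩⟩, ?_, ?_⟩
  · rw [Ideal.PrimePair.compl_F_eq_I]
    exact J.isIdeal
  · intro a ha haJ
    exact Set.disjoint_left.1 hFJ ⟨a, ha, le_rfl⟩ haJ
  · intro b hb hbJ
    exact hbJ (hIJ ⟨b, hb, le_rfl⟩)

/-- By residuation, the filter generated by `x` and `a` omits `b`, so it can be separated from `b`.
-/
theorem exists_le_mem_notMem (x : PrimeFilter A) {a b : A} (h : a ⇨ b ∉ x.1) :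
    ∃ y : PrimeFilter A, x ≤ y ∧ a ∈ y.1 ∧ b ∉ y.1 := by
  have hF : InfClosed {c | ∃ e ∈ x.1, c = e ⊓ a} := by
    rintro _ ⟨d, hd, rfl⟩ _ ⟨e, he, rfl⟩
    exact ⟨d ⊓ e, PFilter.inf_mem hd he, (inf_inf_distrib_right d e a).symm⟩
  obtain ⟨y, hy, hb⟩ := exists_of_infClosed_of_supClosed hF (I := {b}) (by simp)
    ⟨_, ⊤, PFilter.top_mem, rfl⟩ ⟨b, rfl⟩ (by
      rintro _ ⟨e, he, rfl⟩ _ rfl hle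
      exact h (PFilter.mem_of_le (le_himp_iff.2 hle) he))
  refine ⟨y, fun e he => ?_, ?_, hb b rfl⟩
  · exact PFilter.mem_of_le inf_le_left (hy _ ⟨e, he, rfl⟩)
  · exact PFilter.mem_of_le inf_le_right (hy _ ⟨⊤, PFilter.top_mem, rfl⟩)

/-- The dual of a homomorphism is a bounded morphism onto its image. -/
theorem exists_le_comap_eq (h : BrouwerianHom A B) {x z : PrimeFilter B}
    (hz : ∃ a, h.toFun a ∉ z.1) (hxz : ∀ a, h.toFun a ∈ x.1 → h.toFun a ∈ z.1) :
    ∃ y : PrimeFilter B, x ≤ y ∧ ∀ a, h.toFun a ∈ y.1 ↔ h.toFun a ∈ z.1 := by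
  have hF : InfClosed {c | ∃ e ∈ x.1, ∃ a, h.toFun a ∈ z.1 ∧ c = e ⊓ h.toFun a} := by
    rintro _ ⟨d, hd, a, ha, rfl⟩ _ ⟨e, he, b, hb, rfl⟩
    refine ⟨d ⊓ e, PFilter.inf_mem hd he, a ⊓ b, ?_, ?_⟩
    · rw [h.map_inf']
      exact PFilter.inf_mem ha hb
    · rw [h.map_inf', inf_inf_inf_comm]
  have hI : SupClosed {c | ∃ a, h.toFun a ∉ z.1 ∧ c = h.toFun a} := by
    rintro _ ⟨a, ha, rfl⟩ _ ⟨b, hb, rfl⟩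
    refine ⟨a ⊔ b, ?_, (h.map_sup' a b).symm⟩
    rw [h.map_sup']
    exact fun hc => (z.sup_mem_iff.1 hc).elim ha hb
  have htop : h.toFun ⊤ ∈ z.1 := by
    rw [h.map_top']
    exact PFilter.top_mem
  -- If `e ⊓ h a ≤ h b` with `e ∈ x`, then `h (a ⇨ b)` lies in `x`, hence in `z`, and modus ponens
  -- puts `h b` in `z`.
  obtain ⟨y, hy, hb⟩ := exists_of_infClosed_of_supClosed hF hI
    ⟨_, ⊤, PFilter.top_mem, ⊤, htop, rfl⟩ (hz.elim fun a ha => ⟨_, a, ha, rfl⟩) (by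
      rintro _ ⟨e, he, a, ha, rfl⟩ _ ⟨b, hb, rfl⟩ hle
      have hab : h.toFun (a ⇨ b) ∈ z.1 := by
        refine hxz _ (PFilter.mem_of_le ?_ he)
        rw [h.map_himp']
        exact le_himp_iff.2 hle
      rw [h.map_himp'] at hab
      exact hb (PFilter.mem_of_le himp_inf_le (PFilter.inf_mem hab ha)))
  refine ⟨y, fun e he => ?_, fun a => ⟨fun ha => ?_, fun ha => ?_⟩⟩
  · exact PFilter.mem_of_le inf_le_left (hy _ ⟨e, he, ⊤, htop, rfl⟩)
  · by_contra hc
    exact hb _ ⟨a, hc, rfl⟩ ha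
  · exact PFilter.mem_of_le inf_le_right (hy _ ⟨⊤, PFilter.top_mem, a, ha, rfl⟩)

/-! ### Homomorphisms into algebras of up-sets. -/

/-- The homomorphism into an algebra of upper sets that is dual to a bounded morphism. -/
def upperSetHom {X : Type u} [PartialOrder X] (σ : X → PrimeFilter A) (hσ : Monotone σ)
    (hback : ∀ z w, σ z ≤ w → ∃ v, z ≤ v ∧ σ v = w) : BrouwerianHom A (LowerSet Xᵒᵈ) where
  -- Up-sets appear as lower sets of the dual order because `UpperSet` is ordered by reverse
  -- inclusion.
  toFun a := ⟨{z | a ∈ (σ (OrderDual.ofDual z)).1}, fun _ _ hvz hz => hσ hvz hz⟩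
  map_sup' a b := by
    ext z
    exact (σ (OrderDual.ofDual z)).sup_mem_iff
  map_inf' a b := by
    ext z
    exact PFilter.inf_mem_iff
  map_top' := by
    ext z
    exact ⟨fun _ => trivial, fun _ => PFilter.top_mem⟩
  map_himp' a b := by
    apply le_antisymm
    · rw [le_himp_iff]
      rintro z ⟨hz, hz'⟩
      exact PFilter.mem_of_le himp_inf_le (PFilter.inf_mem hz hz')
    · intro z hz
      by_contra hc
      -- A witness against `a ⇨ b` lies above `σ z`; the back condition lifts it to a point of `X`
      -- above `z`.
      obtain ⟨w, hw, ha, hb⟩ := exists_le_mem_notMem _ hc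
      obtain ⟨v, hv, rfl⟩ := hback _ _ hw
      have hvz : OrderDual.toDual v ≤ z := hv
      let U (c : A) : LowerSet Xᵒᵈ :=
        ⟨{z | c ∈ (σ (OrderDual.ofDual z)).1}, fun _ _ hvz hz => hσ hvz hz⟩
      have hle : (U a ⇨ U b) ⊓ U a ≤ U b := himp_inf_le
      have hmem : OrderDual.toDual v ∈ (U a ⇨ U b) ⊓ U a :=
        LowerSet.mem_inf_iff.2 ⟨LowerSet.lower _ hvz hz, ha⟩
      exact hb (hle hmem)

theorem mem_upperSetHom {X : Type u} [PartialOrder X] {σ : X → PrimeFilter A} {hσ : Monotone σ}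
    {hback : ∀ z w, σ z ≤ w → ∃ v, z ≤ v ∧ σ v = w} {a : A} {z : Xᵒᵈ} :
    z ∈ (upperSetHom σ hσ hback).toFun a ↔ a ∈ (σ (OrderDual.ofDual z)).1 :=
  Iff.rfl

/-- The canonical homomorphism into the algebra of upper sets of the prime filters above `x`. -/
def coneHom (x : PrimeFilter A) : BrouwerianHom A (LowerSet {z : PrimeFilter A // x ≤ z}ᵒᵈ) :=
  upperSetHom Subtype.val (fun _ _ h => h) fun z w h => ⟨⟨w, z.2.trans h⟩, h, rfl⟩

/-- Each `w` outside `U` is excluded by some `c w` belonging to all members of `U`, a finite join;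
the finite meet of these `c w` is mapped to `U`. -/
theorem coneHom_surjective (x : PrimeFilter A) [Finite {z : PrimeFilter A // x ≤ z}] :
    Function.Surjective (coneHom x).toFun := by
  intro U
  have key (w : {z : PrimeFilter A // x ≤ z}) (hw : OrderDual.toDual w ∉ U) :
      ∃ c, c ∉ w.1.1 ∧ ∀ z ∈ (U : Set {z : PrimeFilter A // x ≤ z}ᵒᵈ),
        c ∈ (OrderDual.ofDual z).1.1 := by
    have hfin : (U : Set {z : PrimeFilter A // x ≤ z}ᵒᵈ).Finite :=
      Set.toFinite (α := {z : PrimeFilter A // x ≤ z}) _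
    refine hfin.induction_on_subset _ ?_ ?_
    -- Without a least element, any element outside `w` serves as the empty join.
    · exact w.1.exists_notMem.imp fun a ha => ⟨ha, by simp⟩
    · rintro z S hzU - - ⟨c, hc, hcS⟩
      have hzw : ¬ (OrderDual.ofDual z).1.1 ≤ w.1.1 := fun hle => hw (U.lower hle hzU)
      obtain ⟨d, hd, hdw⟩ := SetLike.not_le_iff_exists.1 hzw
      refine ⟨c ⊔ d, fun h => (w.1.sup_mem_iff.1 h).elim hc hdw, ?_⟩
      rintro v (rfl | hv)
      · exact (sup_mem_iff _).2 (.inr hd)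
      · exact (sup_mem_iff _).2 (.inl (hcS v hv))
  choose! c hc hcU using key
  have := Fintype.ofFinite {z : PrimeFilter A // x ≤ z}
  classical
  have hmem (F : PFilter A) (s : Finset {z : PrimeFilter A // x ≤ z}) :
      s.inf c ∈ F ↔ ∀ w ∈ s, c w ∈ F := by
    induction s using Finset.induction_on with
    | empty => simp [PFilter.top_mem]
    | insert w s _ ih => simp [PFilter.inf_mem_iff, ih]
  refine ⟨(Finset.univ.filter fun w => OrderDual.toDual w ∉ U).inf c, ?_⟩
  ext z
  refine mem_upperSetHom.trans ((hmem _ _).trans ⟨fun h => ?_, fun hz w hw => ?_⟩)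
  · by_contra hz
    exact hc (OrderDual.ofDual z) hz (h _ (by simpa using hz))
  · exact hcU w (by simpa using hw) z hz

/-! ### Non-surjective homomorphisms and collapsed prime filters. -/

/-- For `b` outside the range, `x` contains `b` but no range element below `b`, so the range
elements of `x` can be separated from `b` by some `y`. Lifting the preimage of `y` above `x` gives a
prime filter that contains `b`, unlike `y`. -/
theorem exists_ne_comap_eq (h : BrouwerianHom A B) (hh : ¬ Function.Surjective h.toFun)
    (hp : ∀ x : PrimeFilter B, ∃ a, h.toFun a ∉ x.1) :
    ∃ x y : PrimeFilter B, x ≠ y ∧ ∀ a, h.toFun a ∈ x.1 ↔ h.toFun a ∈ y.1 := by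
  obtain ⟨b, hb⟩ := not_forall.1 hh
  have hne : ∃ a, h.toFun a ≤ b := by
    by_contra! hc
    obtain ⟨x, hx, -⟩ := exists_of_infClosed_of_supClosed (F := Set.range h.toFun) (I := {b})
      (by rintro _ ⟨a, rfl⟩ _ ⟨c, rfl⟩; exact ⟨a ⊓ c, h.map_inf' a c⟩) (by simp)
      ⟨_, ⊤, rfl⟩ ⟨b, rfl⟩ (by rintro _ ⟨a, rfl⟩ _ rfl; exact hc a)
    exact (hp x).elim fun a ha => ha (hx _ ⟨a, rfl⟩)
  obtain ⟨x, hx, hxb⟩ := exists_of_infClosed_of_supClosed (F := {b})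
    (I := {c | c ≤ b ∧ c ∈ Set.range h.toFun}) (by simp) (by
      rintro _ ⟨hab, a, rfl⟩ _ ⟨hcb, c, rfl⟩
      exact ⟨sup_le hab hcb, a ⊔ c, h.map_sup' a c⟩) ⟨b, rfl⟩
    (hne.elim fun a ha => ⟨_, ha, a, rfl⟩) (by
      rintro _ rfl _ ⟨hab, a, rfl⟩ hba
      exact hb ⟨a, le_antisymm hab hba⟩)
  obtain ⟨y, hy, hyb⟩ := exists_of_infClosed_of_supClosed
    (F := {c | c ∈ x.1 ∧ c ∈ Set.range h.toFun}) (I := {b}) (by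
      rintro _ ⟨hax, a, rfl⟩ _ ⟨hcx, c, rfl⟩
      exact ⟨PFilter.inf_mem hax hcx, a ⊓ c, h.map_inf' a c⟩) (by simp)
    ⟨_, PFilter.top_mem, ⊤, h.map_top'⟩ ⟨b, rfl⟩ (by
      rintro _ ⟨hax, a, rfl⟩ _ rfl hab
      exact hxb _ ⟨hab, a, rfl⟩ hax)
  obtain ⟨z, hxz, hz⟩ := exists_le_comap_eq h (hp y) fun a ha => hy _ ⟨ha, a, rfl⟩
  refine ⟨z, y, ?_, hz⟩
  rintro rfl
  exact hyb b rfl (hxz (hx b rfl))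

/-- Two distinct prime filters with the same preimage can be chosen such that all prime filters
strictly above one of them are above the other. -/
theorem exists_ne_comap_eq_of_finite (h : BrouwerianHom A B)
    (hfin : ∀ x : PrimeFilter B, Finite {z : PrimeFilter B // x ≤ z})
    (hh : ¬ Function.Surjective h.toFun) (hp : ∀ x : PrimeFilter B, ∃ a, h.toFun a ∉ x.1) :
    ∃ x y : PrimeFilter B, x ≠ y ∧ (∀ a, h.toFun a ∈ x.1 ↔ h.toFun a ∈ y.1) ∧
      (∀ z, x < z → y ≤ z) ∧ (∀ z, y < z → x ≤ z) ∧ ¬ y < x := by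
  let m (p : PrimeFilter B × PrimeFilter B) : ℕ := (Set.Ici p.1).ncard + (Set.Ici p.2).ncard
  have hlt {x y : PrimeFilter B} (hxy : x < y) : (Set.Ici y).ncard < (Set.Ici x).ncard :=
    Set.ncard_lt_ncard (Set.Ici_ssubset_Ici.2 hxy) (hfin x)
  have hle {x y : PrimeFilter B} (hxy : x ≤ y) : (Set.Ici y).ncard ≤ (Set.Ici x).ncard :=
    Set.ncard_le_ncard (Set.Ici_subset_Ici.2 hxy) (hfin x)
  obtain ⟨x₀, y₀, hne₀, heq₀⟩ := exists_ne_comap_eq h hh hp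
  -- The total size of the two cones is minimized. For `z` strictly above one point, the lift `w` of
  -- its preimage above the other point yields a smaller pair unless `z = w`.
  obtain ⟨⟨x, y⟩, ⟨hne, heq⟩, hmin⟩ := (measure m).wf.has_min
    {p | p.1 ≠ p.2 ∧ ∀ a, h.toFun a ∈ p.1.1 ↔ h.toFun a ∈ p.2.1} ⟨(x₀, y₀), hne₀, heq₀⟩
  have hx (z : PrimeFilter B) (hz : x < z) : y ≤ z := by
    obtain ⟨w, hw, hwz⟩ := exists_le_comap_eq h (hp z) (x := y)
      fun a ha => hz.le ((heq a).2 ha)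
    by_cases hzw : z = w
    · exact hzw ▸ hw
    · exact absurd (Nat.add_lt_add_of_lt_of_le (hlt hz) (hle hw))
        (hmin (z, w) ⟨hzw, fun a => (hwz a).symm⟩)
  have hy (z : PrimeFilter B) (hz : y < z) : x ≤ z := by
    obtain ⟨w, hw, hwz⟩ := exists_le_comap_eq h (hp z) (x := x)
      fun a ha => hz.le ((heq a).1 ha)
    by_cases hzw : w = z
    · exact hzw ▸ hw
    · exact absurd (Nat.add_lt_add_of_le_of_lt (hle hw) (hlt hz)) (hmin (w, z) ⟨hzw, hwz⟩)
  by_cases hyx : y < x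
  · exact ⟨y, x, hne.symm, fun a => (heq a).symm, hy, hx, hyx.asymm⟩
  · exact ⟨x, y, hne, heq, hx, hy, hyx⟩

/-- A non-surjective homomorphism `h` does not determine the values of some canonical homomorphism
`coneHom x` outside the range of `h`. -/
theorem exists_coneHom_ne (h : BrouwerianHom A B)
    (hfin : ∀ x : PrimeFilter B, Finite {z : PrimeFilter B // x ≤ z})
    (hh : ¬ Function.Surjective h.toFun) :
    ∃ (x : PrimeFilter B) (g : BrouwerianHom B (LowerSet {z : PrimeFilter B // x ≤ z}ᵒᵈ)),
      (∀ a, g.toFun (h.toFun a) = (coneHom x).toFun (h.toFun a)) ∧ g ≠ coneHom x := by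
  classical
  by_cases hp : ∀ x : PrimeFilter B, ∃ a, h.toFun a ∉ x.1
  · obtain ⟨x, y, hne, heq, hx, hy, hyx⟩ := exists_ne_comap_eq_of_finite h hfin hh hp
    let σ (z : {z : PrimeFilter B // x ≤ z}) : PrimeFilter B := if z.1 = x then y else z.1
    have hσ : Monotone σ := by
      intro z v hzv
      have hzv' : z.1 ≤ v.1 := hzv
      by_cases hz : z.1 = x
      · by_cases hv : v.1 = x
        · simp [σ, hz, hv]
        · simpa [σ, hz, hv] using hx _ (lt_of_le_of_ne v.2 (Ne.symm hv))
      · have hv : v.1 ≠ x := fun hv => hz (le_antisymm (hzv'.trans hv.le) z.2)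
        simpa [σ, hz, hv] using hzv'
    have hback (z : {z : PrimeFilter B // x ≤ z}) (w : PrimeFilter B) (hw : σ z ≤ w) :
        ∃ v, z ≤ v ∧ σ v = w := by
      by_cases hz : z.1 = x
      · replace hw : y ≤ w := by simpa [σ, hz] using hw
        obtain rfl | hlt := hw.eq_or_lt
        · exact ⟨z, le_rfl, by simp [σ, hz]⟩
        -- Here `¬ y < x` is essential: `σ` moves `x`, so `w = x` would not be its own preimage.
        · have hwx : w ≠ x := by
            rintro rfl
            exact hyx hlt
          refine ⟨⟨w, hy w hlt⟩, ?_, by simp [σ, hwx]⟩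
          exact Subtype.coe_le_coe.1 (hz.trans_le (hy w hlt))
      · replace hw : z.1 ≤ w := by simpa [σ, hz] using hw
        have hwx : w ≠ x := by
          rintro rfl
          exact hz (le_antisymm hw z.2)
        exact ⟨⟨w, z.2.trans hw⟩, hw, by simp [σ, hwx]⟩
    refine ⟨x, upperSetHom σ hσ hback, fun a => ?_, fun hc => hne (ext_mem fun b => ?_)⟩
    · ext z
      refine mem_upperSetHom.trans (Iff.trans ?_ mem_upperSetHom.symm)
      by_cases hz : (OrderDual.ofDual z).1 = x
      · simpa [σ, hz] using (heq a).symm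
      · simp [σ, hz]
    · have hb : OrderDual.toDual ⟨x, le_rfl⟩ ∈ (upperSetHom σ hσ hback).toFun b ↔
          OrderDual.toDual ⟨x, le_rfl⟩ ∈ (coneHom x).toFun b := by rw [hc]
      simpa [σ] using (mem_upperSetHom.symm.trans (hb.symm.trans mem_upperSetHom))
  · push Not at hp
    obtain ⟨x, hx⟩ := hp
    -- The range of `h` lies in `x`, so `coneHom x` is constantly `⊤` on it.
    let g : BrouwerianHom B (LowerSet {z : PrimeFilter B // x ≤ z}ᵒᵈ) :=
      { toFun _ := ⊤
        map_sup' _ _ := by simp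
        map_inf' _ _ := by simp
        map_top' := rfl
        map_himp' _ _ := by simp }
    refine ⟨x, g, fun a => ?_, fun hc => ?_⟩
    · ext z
      exact ⟨fun _ => (OrderDual.ofDual z).2 (hx a), fun _ => trivial⟩
    · obtain ⟨b, hb⟩ := x.exists_notMem
      have hb' : OrderDual.toDual ⟨x, le_rfl⟩ ∈ (coneHom x).toFun b := by
        rw [← hc]
        trivial
      exact hb hb'

end PrimeFilter

/-! ### Bounded prime quotients, finite cones and depth. -/

/-- Any upper bound of the elements `f i ⇔ f j`, where `f` is a family of `k + 1` elements, is the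
top element. This expresses by an equation that all quotients by prime filters have at most `k`
elements. -/
def PrimeQuotientCardLE (k : ℕ) (A : Type u) [GeneralizedHeytingAlgebra A] : Prop :=
  ∀ (f : Fin (k + 1) → A) (c : A), (∀ i j, i ≠ j → bihimp (f i) (f j) ≤ c) → c = ⊤

namespace PrimeQuotientCardLE

variable {A B : Type u} [GeneralizedHeytingAlgebra A] [GeneralizedHeytingAlgebra B] {k : ℕ}

theorem map_bihimp (h : BrouwerianHom A B) (a b : A) :
    h.toFun (bihimp a b) = bihimp (h.toFun a) (h.toFun b) := by
  rw [bihimp, bihimp, h.map_inf', h.map_himp', h.map_himp']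

theorem of_finite [Finite A] (hk : Nat.card A ≤ k) : PrimeQuotientCardLE k A := by
  intro f c hc
  obtain ⟨i, j, hij, hf⟩ : ∃ i j, i ≠ j ∧ f i = f j := by
    by_contra! hne
    have := Nat.card_le_card_of_injective f fun i j hf => by_contra fun hij => hne i j hij hf
    simp at this
    omega
  have := hc i j hij
  rwa [hf, bihimp_self, top_le_iff] at this

/-- A nonempty directed set bounds finite families, even the empty family arising for `k = 0`, so no
bottom element is needed. -/
theorem exists_upperBound_mem {I : Set A} (hI : IsIdeal I) (f : Fin (k + 1) → A)
    (hf : ∀ i j, i ≠ j → bihimp (f i) (f j) ∈ I) :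
    ∃ c ∈ I, ∀ i j, i ≠ j → bihimp (f i) (f j) ≤ c := by
  let g (p : {p : Fin (k + 1) × Fin (k + 1) // p.1 ≠ p.2}) : I := ⟨_, hf p.1.1 p.1.2 p.2⟩
  have : Nonempty I := hI.Nonempty.to_subtype
  obtain ⟨c, hc⟩ := (directedOn_iff_directed.1 hI.Directed).finite_le g
  exact ⟨c, c.2, fun i j hij => hc ⟨(i, j), hij⟩⟩

/-- Implications need not pass to quotients; this one does because the preimage of the principal
ideal of `c` is an ideal, and so contains an upper bound for the lifted elements. -/
theorem of_surjective (hA : PrimeQuotientCardLE k A) (h : BrouwerianHom A B)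
    (hh : Function.Surjective h.toFun) : PrimeQuotientCardLE k B := by
  intro f c hc
  choose r hr using hh
  have hmono : Monotone h.toFun := OrderHomClass.mono h.toLatticeHom
  have hI : IsIdeal {a | h.toFun a ≤ c} := by
    refine ⟨fun a b hba ha => (hmono hba).trans ha, ⟨r c, (hr c).le⟩, fun a ha b hb =>
      ⟨a ⊔ b, ?_, le_sup_left, le_sup_right⟩⟩
    change h.toFun (a ⊔ b) ≤ c
    rw [h.map_sup']
    exact sup_le ha hb
  obtain ⟨d, hd, hfd⟩ := exists_upperBound_mem hI (fun i => r (f i)) fun i j hij => by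
    change h.toFun _ ≤ c
    rw [map_bihimp, hr, hr]
    exact hc i j hij
  rw [← top_le_iff, ← h.map_top', ← hA _ d hfd]
  exact hd

theorem of_injective (hB : PrimeQuotientCardLE k B) (h : BrouwerianHom A B)
    (hh : Function.Injective h.toFun) : PrimeQuotientCardLE k A := by
  intro f c hc
  have hmono : Monotone h.toFun := OrderHomClass.mono h.toLatticeHom
  refine hh ((hB (fun i => h.toFun (f i)) _ fun i j hij => ?_).trans h.map_top'.symm)
  rw [← map_bihimp]
  exact hmono (hc i j hij)

theorem pi {ι : Type u} {A : ι → Type u} [∀ i, GeneralizedHeytingAlgebra (A i)]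
    (hA : ∀ i, PrimeQuotientCardLE k (A i)) : PrimeQuotientCardLE k (∀ i, A i) := by
  intro f c hc
  funext s
  exact hA s (fun i => f i s) (c s) fun i j hij => hc i j hij s

/-- Otherwise the complement of `x`, an ideal, would contain an upper bound of all `f i ⇔ f j`, that
is, `⊤`. -/
theorem exists_bihimp_mem (hA : PrimeQuotientCardLE k A) (x : PrimeFilter A)
    (f : Fin (k + 1) → A) : ∃ i j, i ≠ j ∧ bihimp (f i) (f j) ∈ x.1 := by
  by_contra! hc
  obtain ⟨c, hcx, hfc⟩ := exists_upperBound_mem x.2.compl_ideal f hc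
  rw [hA f c hfc] at hcx
  exact hcx PFilter.top_mem

/-- There are at most `2 ^ k` prime filters above a given one. -/
theorem finite_cone (hA : PrimeQuotientCardLE k A) (x : PrimeFilter A) :
    Finite {z : PrimeFilter A // x ≤ z} ∧ Nat.card {z : PrimeFilter A // x ≤ z} ≤ 2 ^ k := by
  -- `R` plays the role of the quotient by `x`: elements whose `bihimp` lies in `x` have equal
  -- images.
  let R := Set.range (x.coneHom).toFun
  have hR : ¬ Nonempty (Fin (k + 1) ↪ R) := by
    rintro ⟨e⟩
    choose f hf using fun i => (e i).2
    obtain ⟨i, j, hij, hx⟩ := hA.exists_bihimp_mem x f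
    refine hij (e.injective (Subtype.ext ?_))
    rw [← hf, ← hf]
    ext z
    have hz := PFilter.inf_mem_iff.1 ((OrderDual.ofDual z).2 hx)
    refine PrimeFilter.mem_upperSetHom.trans (Iff.trans ⟨fun h => ?_, fun h => ?_⟩
      PrimeFilter.mem_upperSetHom.symm)
    · exact PFilter.mem_of_le himp_inf_le (PFilter.inf_mem hz.2 h)
    · exact PFilter.mem_of_le himp_inf_le (PFilter.inf_mem hz.1 h)
  have hRfin : Finite R := by
    by_contra hinf
    rw [not_finite_iff_infinite] at hinf
    exact hR ⟨Fin.valEmbedding.trans (Infinite.natEmbedding R)⟩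
  have hRcard : Nat.card R ≤ k := by
    by_contra! hlt
    have := Fintype.ofFinite R
    exact hR (Function.Embedding.nonempty_of_card_le (by
      rw [Fintype.card_fin, ← Nat.card_eq_fintype_card]
      exact hlt))
  let φ (z : {z : PrimeFilter A // x ≤ z}) : Set R := {U | OrderDual.toDual z ∈ U.1}
  have hφ : Function.Injective φ := by
    intro z w hzw
    refine Subtype.ext (PrimeFilter.ext_mem fun a => ?_)
    exact Set.ext_iff.1 hzw ⟨_, a, rfl⟩
  refine ⟨Finite.of_injective φ hφ, (Nat.card_le_card_of_injective φ hφ).trans ?_⟩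
  have := Fintype.ofFinite R
  rw [Nat.card_eq_fintype_card, Fintype.card_set, ← Nat.card_eq_fintype_card]
  exact Nat.pow_le_pow_right two_pos hRcard

theorem latticeDepth_le (hA : PrimeQuotientCardLE k A) : latticeDepth A ≤ (2 ^ k : ℕ) := by
  refine iSup_le fun x => ?_
  obtain ⟨hfin, hcard⟩ := hA.finite_cone x
  -- `coheight` counts the steps of a chain, `latticeDepth` its elements.
  have hx : coheight x ≤ (2 ^ k - 1 : ℕ) := by
    refine coheight_le fun p hp => Nat.cast_le.2 ?_
    have := Nat.card_le_card_of_injective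
      (fun i => (⟨p i, hp ▸ p.monotone (Fin.zero_le i)⟩ : {z : PrimeFilter A // x ≤ z}))
      fun i j hij => p.strictMono.injective (congrArg Subtype.val hij)
    rw [Nat.card_fin] at this
    omega
  refine (add_le_add_left hx 1).trans ?_
  have := Nat.one_le_two_pow (n := k)
  exact_mod_cast (Nat.sub_add_cancel this).le

end PrimeQuotientCardLE

/-! ### Passage to varieties. -/

/-- A Heyting homomorphism, regarded as a homomorphism of Brouwerian algebras. -/
def HeytingHom.toBrouwerianHom {A B : Type u} [HeytingAlgebra A] [HeytingAlgebra B]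
    (h : HeytingHom A B) : BrouwerianHom A B :=
  { h with map_top' := map_top h }

theorem HeytingVariety.isVariety_primeQuotientCardLE (k : ℕ) :
    IsVariety {A : HeytAlg.{u} | PrimeQuotientCardLE k A} where
  hom_image _ hA _ f hf := PrimeQuotientCardLE.of_surjective hA f.toBrouwerianHom hf
  subalgebra _ hB _ f hf := PrimeQuotientCardLE.of_injective hB f.toBrouwerianHom hf
  product _ _ hA := PrimeQuotientCardLE.pi hA

theorem BrouwerianVariety.isVariety_primeQuotientCardLE (k : ℕ) :
    IsVariety {A : BrouwerianAlg.{u} | PrimeQuotientCardLE k A} where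
  hom_image _ hA _ f hf := PrimeQuotientCardLE.of_surjective hA f hf
  subalgebra _ hB _ f hf := PrimeQuotientCardLE.of_injective hB f hf
  product _ _ hA := PrimeQuotientCardLE.pi hA

theorem HeytingVariety.IsFinitelyGenerated.exists_primeQuotientCardLE {K : Set HeytAlg.{u}}
    (hK : IsFinitelyGenerated K) : ∃ k, ∀ A ∈ K, PrimeQuotientCardLE k A := by
  obtain ⟨M, hM, hfin, rfl⟩ := hK
  obtain ⟨k, hk⟩ := (Set.Finite.image (fun A : HeytAlg.{u} => Nat.card A) hM).bddAbove
  refine ⟨k, fun A hA => hA _ ⟨isVariety_primeQuotientCardLE k, fun B hB => ?_⟩⟩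
  have := hfin B hB
  exact PrimeQuotientCardLE.of_finite (hk ⟨B, hB, rfl⟩)

theorem BrouwerianVariety.IsFinitelyGenerated.exists_primeQuotientCardLE
    {K : Set BrouwerianAlg.{u}} (hK : IsFinitelyGenerated K) :
    ∃ k, ∀ A ∈ K, PrimeQuotientCardLE k A := by
  obtain ⟨M, hM, hfin, rfl⟩ := hK
  obtain ⟨k, hk⟩ := (Set.Finite.image (fun A : BrouwerianAlg.{u} => Nat.card A) hM).bddAbove
  refine ⟨k, fun A hA => hA _ ⟨isVariety_primeQuotientCardLE k, fun B hB => ?_⟩⟩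
  have := hfin B hB
  exact PrimeQuotientCardLE.of_finite (hk ⟨B, hB, rfl⟩)

theorem HeytingVariety.IsVariety.hasES {K : Set HeytAlg.{u}} (hK : IsVariety K) {k : ℕ}
    (hk : ∀ A ∈ K, PrimeQuotientCardLE k A) : HasES K := by
  intro A _ B hB h hepi
  by_contra hh
  obtain ⟨x, g, hg, hne⟩ := PrimeFilter.exists_coneHom_ne h.toBrouwerianHom
    (fun x => ((hk B hB).finite_cone x).1) hh
  have := ((hk B hB).finite_cone x).1
  -- Prime filters are proper, so `coneHom` preserves `⊥`. As `⊥ = h ⊥` is in the range of `h`,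
  -- where `g` agrees with `coneHom`, so does `g`.
  have hbot : x.coneHom.toFun ⊥ = ⊥ := by
    ext z
    refine PrimeFilter.mem_upperSetHom.trans ⟨fun hz => ?_, fun hz => hz.elim⟩
    exact (PrimeFilter.exists_notMem _).elim fun a ha => ha (PFilter.mem_of_le bot_le hz)
  have hhbot : h.toBrouwerianHom.toFun ⊥ = ⊥ := map_bot h
  have hgbot : g.toFun ⊥ = ⊥ := by
    have := hg ⊥
    rwa [hhbot, hbot] at this
  let f' : HeytingHom B (HeytAlg.of (LowerSet {z : PrimeFilter B // x ≤ z}ᵒᵈ)) :=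
    { x.coneHom with map_bot' := hbot }
  let g' : HeytingHom B (HeytAlg.of (LowerSet {z : PrimeFilter B // x ≤ z}ᵒᵈ)) :=
    { g with map_bot' := hgbot }
  have heq : g' = f' := hepi _ (hK.hom_image B hB _ f' x.coneHom_surjective) g' f'
    (HeytingHom.ext hg)
  exact hne (congrArg HeytingHom.toBrouwerianHom heq)

theorem BrouwerianVariety.IsVariety.hasES {K : Set BrouwerianAlg.{u}} (hK : IsVariety K) {k : ℕ}
    (hk : ∀ A ∈ K, PrimeQuotientCardLE k A) : HasES K := by
  intro A _ B hB h hepi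
  by_contra hh
  obtain ⟨x, g, hg, hne⟩ := PrimeFilter.exists_coneHom_ne h
    (fun x => ((hk B hB).finite_cone x).1) hh
  have := ((hk B hB).finite_cone x).1
  exact hne (hepi ⟨_⟩ (hK.hom_image B hB _ x.coneHom x.coneHom_surjective) g x.coneHom
    (funext hg))

theorem mainTheorem11 :
    (∀ K : Set HeytAlg.{u}, HeytingVariety.IsFinitelyGenerated K →
      HeytingVariety.HasES K ∧ HeytingVariety.depth K < ⊤) ∧
    (∀ K : Set BrouwerianAlg.{u}, BrouwerianVariety.IsFinitelyGenerated K →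
      BrouwerianVariety.HasES K ∧ BrouwerianVariety.depth K < ⊤) := by
  refine ⟨fun K hK => ?_, fun K hK => ?_⟩
  · obtain ⟨k, hk⟩ := hK.exists_primeQuotientCardLE
    obtain ⟨M, -, -, rfl⟩ := hK
    exact ⟨(HeytingVariety.isVariety_generated M).hasES hk,
      (iSup₂_le fun A hA => (hk A hA).latticeDepth_le).trans_lt (ENat.natCast_lt_top _)⟩
  · obtain ⟨k, hk⟩ := hK.exists_primeQuotientCardLE
    obtain ⟨M, -, -, rfl⟩ := hK
    exact ⟨(BrouwerianVariety.isVariety_generated M).hasES hk,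
      (iSup₂_le fun A hA => (hk A hA).latticeDepth_le).trans_lt (ENat.natCast_lt_top _)⟩
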